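/- Let $k$ be a field of characteristic $2$, let $k^{1/2}$ denote the extension of $k$ obtained by adjoining the square roots of all elements of $k$, and let $X \subset \mathbb{P}^4_k$ be a smooth complete intersection of two quadrics, that is, the closed subscheme $X = V(q_0,q_1)$ defined by two quadratic forms $q_0, q_1 \in k[x_0,\dots,x_4]$, where $X$ is smooth over $k$ and of dimension $2$. Then $X(k^{1/2}) \neq \emptyset$. If moreover $k$ is a local or global field of characteristic $2$, then $[k^{1/2}:k] = 2$; in particular, every such $X$ has a point over a quadratic extension of $k$, namely $k^{1/2}$. -/

import Mathlib

open AlgebraicGeometry CategoryTheory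

universe u

/-- Two quadratic forms `q₀, q₁` in the variables `x₀, …, x₄` over `k`: the defining equations of an
intersection of two quadrics in `ℙ⁴`. -/
structure QuadricPair (k : Type u) [Field k] where
  form : Fin 2 → MvPolynomial (Fin 5) k
  isHomogeneous : ∀ i, (form i).IsHomogeneous 2

namespace QuadricPair

variable {k : Type u} [Field k] (X : QuadricPair k)

/-- The homogeneous ideal `(q₀, q₁)` of `k[x₀, …, x₄]`. -/
noncomputable def ideal : Ideal (MvPolynomial (Fin 5) k) :=
  Ideal.span (Set.range X.form)

/-- The homogeneous coordinate ring `k[x₀, …, x₄] / (q₀, q₁)`. -/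
noncomputable abbrev CoordRing : Type u :=
  MvPolynomial (Fin 5) k ⧸ X.ideal

/-- The degree `d` part of the homogeneous coordinate ring: the classes of the forms of degree
`d`. -/
noncomputable def grading (d : ℕ) : Submodule k X.CoordRing :=
  (MvPolynomial.homogeneousSubmodule (Fin 5) k d).map (Ideal.Quotient.mkₐ k X.ideal).toLinearMap

theorem mk_mem_grading {d : ℕ} {p : MvPolynomial (Fin 5) k} (hp : p.IsHomogeneous d) :
    Ideal.Quotient.mk X.ideal p ∈ X.grading d :=
  ⟨p, (MvPolynomial.mem_homogeneousSubmodule d p).mpr hp, rfl⟩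

instance : SetLike.GradedMonoid X.grading where
  one_mem := X.mk_mem_grading (MvPolynomial.isHomogeneous_one (Fin 5) k)
  mul_mem := by
    rintro i j _ _ ⟨p, hp, rfl⟩ ⟨q, hq, rfl⟩
    exact X.mk_mem_grading
      (((MvPolynomial.mem_homogeneousSubmodule i p).mp hp).mul
        ((MvPolynomial.mem_homogeneousSubmodule j q).mp hq))

attribute [local instance] MvPolynomial.gradedAlgebra

/-- The quotient map `k[x₀, …, x₄]_d → (k[x₀, …, x₄] / (q₀, q₁))_d`. -/
noncomputable def gradedMk (d : ℕ) :
    MvPolynomial.homogeneousSubmodule (Fin 5) k d →ₗ[k] X.grading d :=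
  (Ideal.Quotient.mkₐ k X.ideal).toLinearMap.restrict fun p hp => ⟨p, hp, rfl⟩

/-- A polynomial goes to the family of the classes of its homogeneous components. -/
noncomputable def decomposeMk :
    MvPolynomial (Fin 5) k →ₐ[k] DirectSum ℕ fun d => X.grading d :=
  (DirectSum.toAlgebra k (fun d => MvPolynomial.homogeneousSubmodule (Fin 5) k d)
    (fun d => (DirectSum.lof k ℕ (fun d => X.grading d) d).comp (X.gradedMk d))
    rfl
    (fun {i j} a b => by
      simp only [LinearMap.comp_apply, DirectSum.lof_eq_of]
      rw [DirectSum.of_mul_of]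
      rfl)).comp
  (DirectSum.decomposeAlgEquiv
    (fun d => MvPolynomial.homogeneousSubmodule (Fin 5) k d)).toAlgHom

theorem decomposeMk_of_isHomogeneous {d : ℕ} {p : MvPolynomial (Fin 5) k}
    (hp : p.IsHomogeneous d) :
    X.decomposeMk p =
      DirectSum.of (fun d => X.grading d) d
        ⟨Ideal.Quotient.mk X.ideal p, X.mk_mem_grading hp⟩ := by
  have h : DirectSum.decompose (fun d => MvPolynomial.homogeneousSubmodule (Fin 5) k d) p =
      DirectSum.of (fun d => MvPolynomial.homogeneousSubmodule (Fin 5) k d) d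
        ⟨p, (MvPolynomial.mem_homogeneousSubmodule d p).mpr hp⟩ :=
    DirectSum.decompose_of_mem _ _
  simp only [decomposeMk, AlgHom.comp_apply]
  change DirectSum.toAlgebra k _ _ _ _ (DirectSum.decompose _ p) = _
  rw [h]
  erw [DirectSum.toAlgebra_apply, DirectSum.toSemiring_of]
  rfl

/-- The homogeneous coordinate ring is graded by degree. -/
noncomputable instance : GradedAlgebra X.grading :=
  GradedAlgebra.ofAlgHom X.grading
    (Ideal.Quotient.liftₐ X.ideal X.decomposeMk (by
      intro a ha
      have hle : X.ideal ≤ RingHom.ker X.decomposeMk := by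
        refine Ideal.span_le.mpr ?_
        rintro _ ⟨i, rfl⟩
        change X.decomposeMk (X.form i) = 0
        rw [X.decomposeMk_of_isHomogeneous (X.isHomogeneous i)]
        have : (⟨Ideal.Quotient.mk X.ideal (X.form i),
            X.mk_mem_grading (X.isHomogeneous i)⟩ : X.grading 2) = 0 :=
          Subtype.ext (Ideal.Quotient.eq_zero_iff_mem.mpr (Ideal.subset_span ⟨i, rfl⟩))
        rw [this, map_zero]
      exact hle ha))
    (by
      apply Ideal.Quotient.algHom_ext
      apply MvPolynomial.algHom_ext
      intro i
      have h := X.decomposeMk_of_isHomogeneous (MvPolynomial.isHomogeneous_X k i)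
      simp only [AlgHom.comp_apply, Ideal.Quotient.mkₐ_eq_mk, AlgHom.id_apply]
      change DirectSum.coeAlgHom X.grading (X.decomposeMk (MvPolynomial.X i)) = _
      rw [h]
      exact DirectSum.coeAlgHom_of _ _ _)
    (by
      rintro d ⟨_, p, hp, rfl⟩
      exact X.decomposeMk_of_isHomogeneous ((MvPolynomial.mem_homogeneousSubmodule d p).mp hp))

/-- The closed subscheme `X = V(q₀, q₁)` of `ℙ⁴_k`, that is `Proj k[x₀, …, x₄] / (q₀, q₁)`. -/
noncomputable abbrev scheme : Scheme.{u} :=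
  Proj X.grading

/-- The structure morphism `X ⟶ Spec k`. -/
noncomputable def structureMorphism : X.scheme ⟶ Spec (CommRingCat.of k) :=
  Proj.toSpecZero X.grading ≫ Spec.map (CommRingCat.ofHom (algebraMap k (X.grading 0)))

/-- `X` is a smooth complete intersection of two quadrics in `ℙ⁴_k`: it is smooth over `k`, and has
codimension two in `ℙ⁴_k`, the number of its equations (so that its dimension is two). -/
def IsSmoothCompleteIntersection : Prop :=
  Smooth X.structureMorphism ∧ topologicalKrullDim X.scheme = 2

/-- `X(L)`: the morphisms of `k`-schemes `Spec L ⟶ X`. -/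
def Point (L : Type u) [Field L] [Algebra k L] : Type u :=
  { x : Spec (CommRingCat.of L) ⟶ X.scheme //
    x ≫ X.structureMorphism = Spec.map (CommRingCat.ofHom (algebraMap k L)) }

end QuadricPair

/-- A local field: a nonarchimedean local field (for a suitable valuation and its topology), or a
field isomorphic to `ℝ` or `ℂ`. -/
def IsLocalField (k : Type u) [Field k] : Prop :=
  (∃ (_ : ValuativeRel k) (_ : TopologicalSpace k), IsNonarchimedeanLocalField k) ∨
    Nonempty (k ≃+* ℝ) ∨ Nonempty (k ≃+* ℂ)

/-- A global field: a number field, or a finite extension of the field of rational functions `F(t)`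
over a finite field `F`. -/
def IsGlobalField (k : Type u) [Field k] : Prop :=
  NumberField k ∨
    ∃ (F : Type) (_ : Field F) (_ : Finite F) (_ : Algebra (RatFunc F) k), FunctionField F k

/-! In characteristic 2 the polar form of a quadratic form is alternating. An alternating form in
odd dimension has a nonzero radical vector; used in dimension 5 and again in dimension 3, this
yields a 3-dimensional subspace of `k⁵` with a basis `v₀, v₁, v₂` that is orthogonal for both polar
forms (`exists_linearIndependent_isotropic`). There each form is diagonal, so over `k^{1/2}` it is
the square of a linear form: `q(∑ yⱼ vⱼ) = ∑ q(vⱼ) yⱼ² = (∑ √q(vⱼ) yⱼ)²`. Two linear equations in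
three unknowns have a nonzero solution.

Extracting roots identifies `k^{1/2}` over `k` with `k` over `k²`, so the degree is 2 once `k = k² ⊕
t k²`. For `F(t)` with `F` perfect, `t` is the variable, and finite extensions preserve the degree.
For a local field, `t` is a uniformizer: `x = a² + t b²` is solved modulo every power of `t`, then
exactly by compactness. -/

namespace QuadricPair

variable {k : Type u} [Field k] (X : QuadricPair k)

/-- A nonzero common zero `a ∈ L⁵` of the two forms gives an `L`-point of `X`. -/
theorem nonempty_point_of_aeval_eq_zero {L : Type u} [Field L] [Algebra k L] (a : Fin 5 → L)
    (ha : a ≠ 0) (h : ∀ i, MvPolynomial.aeval a (X.form i) = 0) : Nonempty (X.Point L) := by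
  obtain ⟨j, hj⟩ := Function.ne_iff.mp ha
  let φ : X.CoordRing →ₐ[k] L := Ideal.Quotient.liftₐ X.ideal (MvPolynomial.aeval a) (by
    intro p hp
    have hle : X.ideal ≤ RingHom.ker (MvPolynomial.aeval a : _ →ₐ[k] L) := by
      refine Ideal.span_le.mpr ?_
      rintro _ ⟨i, rfl⟩
      exact h i
    exact hle hp)
  -- Since `a j ≠ 0`, the point lies in the affine chart where the `j`-th coordinate is invertible.
  let f : X.CoordRing := Ideal.Quotient.mk X.ideal (MvPolynomial.X j)
  have hf : f ∈ X.grading 1 := X.mk_mem_grading (MvPolynomial.isHomogeneous_X k j)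
  have hφf : φ f = a j := MvPolynomial.aeval_X a j
  have hu : IsUnit (φ.toRingHom f) := by
    change IsUnit (φ f)
    rw [hφf]
    exact IsUnit.mk0 _ hj
  let ψ : HomogeneousLocalization.Away X.grading f →+* L :=
    (IsLocalization.Away.lift (S := Localization.Away f) f hu).comp
      (algebraMap (HomogeneousLocalization.Away X.grading f) (Localization.Away f))
  have hψ : (ψ.comp (HomogeneousLocalization.fromZeroRingHom X.grading _)).comp
      (algebraMap k (X.grading 0)) = algebraMap k L := by
    ext c
    change IsLocalization.Away.lift (S := Localization.Away f) f hu
      (algebraMap X.CoordRing (Localization.Away f) (algebraMap k X.CoordRing c)) = _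
    rw [IsLocalization.Away.lift_eq]
    exact φ.commutes c
  refine ⟨Spec.map (CommRingCat.ofHom ψ) ≫ Proj.awayι X.grading f hf one_pos, ?_⟩
  rw [structureMorphism, Category.assoc, Proj.awayι_toSpecZero_assoc, ← Spec.map_comp,
    ← Spec.map_comp, ← hψ]
  rfl

end QuadricPair

/-! ### Quadratic forms and isotropic subspaces -/

/-- A homogeneous polynomial of degree two defines a quadratic form. -/
theorem MvPolynomial.IsHomogeneous.exists_quadraticForm {R σ : Type*} [CommRing R]
    {p : MvPolynomial σ R} (hp : p.IsHomogeneous 2) :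
    ∃ Q : QuadraticForm R (σ → R), ∀ v, Q v = MvPolynomial.eval v p := by
  have hlin : ∀ q ∈ MvPolynomial.homogeneousSubmodule σ R 1,
      ∃ f : (σ → R) →ₗ[R] R, ∀ v, f v = MvPolynomial.eval v q := by
    intro q hq
    rw [MvPolynomial.homogeneousSubmodule_one_eq_span_X] at hq
    induction hq using Submodule.span_induction with
    | mem x hx =>
      obtain ⟨i, rfl⟩ := hx
      exact ⟨LinearMap.proj i, fun v => by simp⟩
    | zero => exact ⟨0, fun v => by simp⟩
    | add x y _ _ hx hy =>
      obtain ⟨f, hf⟩ := hx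
      obtain ⟨g, hg⟩ := hy
      exact ⟨f + g, fun v => by simp [hf, hg]⟩
    | smul c x _ hx =>
      obtain ⟨f, hf⟩ := hx
      exact ⟨c • f, fun v => by simp [hf]⟩
  have hp' : p ∈ MvPolynomial.homogeneousSubmodule σ R 1 *
      MvPolynomial.homogeneousSubmodule σ R 1 := by
    rw [← pow_two, MvPolynomial.homogeneousSubmodule_one_pow]
    exact hp
  clear hp
  induction hp' using Submodule.mul_induction_on' with
  | mem_mul_mem x hx y hy =>
    obtain ⟨f, hf⟩ := hlin x hx
    obtain ⟨g, hg⟩ := hlin y hy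
    exact ⟨QuadraticMap.linMulLin f g, fun v => by simp [hf, hg]⟩
  | add x _ y _ hx hy =>
    obtain ⟨f, hf⟩ := hx
    obtain ⟨g, hg⟩ := hy
    exact ⟨f + g, fun v => by simp [hf, hg]⟩

/-- An alternating form on a space of odd dimension is degenerate. -/
theorem LinearMap.BilinForm.IsAlt.exists_ne_zero_of_odd_finrank {K : Type*} [Field K] :
    ∀ (n : ℕ) {V : Type*} [AddCommGroup V] [Module K V] [FiniteDimensional K V]
      {B : LinearMap.BilinForm K V}, B.IsAlt → Module.finrank K V = 2 * n + 1 →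
      ∃ v : V, v ≠ 0 ∧ ∀ w, B v w = 0 := by
  intro n
  induction n with
  | zero =>
    intro V _ _ _ B hB hV
    obtain ⟨v, hv, hspan⟩ := finrank_eq_one_iff'.mp hV
    refine ⟨v, hv, fun w => ?_⟩
    obtain ⟨c, rfl⟩ := hspan w
    rw [map_smul, hB v, smul_zero]
  | succ n ih =>
    intro V _ _ _ B hB hV
    by_cases h0 : ∀ x y, B x y = 0
    · have : Nontrivial V := Module.nontrivial_of_finrank_pos (R := K) (by omega)
      obtain ⟨v, hv⟩ := exists_ne (0 : V)
      exact ⟨v, hv, h0 v⟩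
    push Not at h0
    obtain ⟨x, y, hxy⟩ := h0
    have hyx : B y x = -B x y := by rw [hB.neg_eq x y]
    -- The plane spanned by `x` and `y` is nondegenerate, so its orthogonal `ker F` is a complement
    -- of dimension two less.
    let F : V →ₗ[K] K × K := (B x).prod (B y)
    have hF : LinearMap.range F = ⊤ := by
      rw [LinearMap.range_eq_top]
      rintro ⟨s, t⟩
      refine ⟨(s / B x y) • y - (t / B x y) • x, ?_⟩
      ext
      · simp [F, hB x, hxy]
      · simp [F, hB y, hxy, hyx]
    have hW : Module.finrank K (LinearMap.ker F) = 2 * n + 1 := by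
      have := F.finrank_range_add_finrank_ker
      rw [hF, finrank_top, Module.finrank_prod, Module.finrank_self, hV] at this
      omega
    obtain ⟨⟨z, hz⟩, hz0, hzW⟩ := ih (B := B.restrict (LinearMap.ker F)) (fun w => hB w) hW
    have hxz : B x z = 0 := congrArg Prod.fst hz
    have hyz : B y z = 0 := congrArg Prod.snd hz
    have hzx : B z x = 0 := by rw [← hB.neg_eq, hxz, neg_zero]
    have hzy : B z y = 0 := by rw [← hB.neg_eq, hyz, neg_zero]
    refine ⟨z, fun h => hz0 (Subtype.ext h), fun v => ?_⟩
    -- Projection of `v` to `ker F` along the span of `x` and `y`, both orthogonal to `z`.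
    have hv : v - (B x v / B x y) • y + (B y v / B x y) • x ∈ LinearMap.ker F := by
      rw [LinearMap.mem_ker]
      ext
      · simp [F, hB x, hxy]
      · simp [F, hB y, hxy, hyx]
    have := hzW ⟨_, hv⟩
    change B z (v - (B x v / B x y) • y + (B y v / B x y) • x) = 0 at this
    simpa [hzx, hzy] using this

/-- Given two bilinear forms on a five-dimensional space, the first of them alternating, there are
three independent vectors, each of which is orthogonal to the following ones for both forms. In
particular two alternating forms have a common totally isotropic subspace of dimension three. -/
theorem exists_linearIndependent_isotropic {K V : Type*} [Field K] [AddCommGroup V] [Module K V]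
    (hV : Module.finrank K V = 5) {B₀ B₁ : LinearMap.BilinForm K V} (h₀ : B₀.IsAlt) :
    ∃ v : Fin 3 → V, LinearIndependent K v ∧
      ∀ i j, i < j → B₀ (v i) (v j) = 0 ∧ B₁ (v i) (v j) = 0 := by
  have : FiniteDimensional K V := Module.finite_of_finrank_pos (by omega)
  obtain ⟨x, hx, hx0⟩ := h₀.exists_ne_zero_of_odd_finrank 2 hV
  have hdual : ∀ {u : V}, u ≠ 0 → ∃ f : Module.Dual K V, f u ≠ 0 := by
    intro u hu
    by_contra! h
    exact hu ((Module.forall_dual_apply_eq_zero_iff K u).mp h)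
  obtain ⟨f, hf⟩ := hdual hx
  -- The condition `f = 0` keeps `x` out of the kernel; `g` below plays the same role for `y`.
  let F : V →ₗ[K] K × K := (B₁ x).prod f
  have hF : 3 ≤ Module.finrank K (LinearMap.ker F) := by
    have h := F.finrank_range_add_finrank_ker
    have h' := Submodule.finrank_le (LinearMap.range F)
    rw [Module.finrank_prod, Module.finrank_self] at h'
    omega
  obtain ⟨e, he⟩ := exists_linearIndependent_of_le_finrank hF
  obtain ⟨S, hSF, hS⟩ : ∃ S : Submodule K V, S ≤ LinearMap.ker F ∧ Module.finrank K S = 3 := by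
    refine ⟨Submodule.span K (Set.range fun i => (e i : V)), ?_, ?_⟩
    · rw [Submodule.span_le]
      rintro _ ⟨i, rfl⟩
      exact (e i).2
    · have he' := he.map' (LinearMap.ker F).subtype (Submodule.ker_subtype _)
      exact (finrank_span_eq_card he').trans (Fintype.card_fin 3)
  have h₀S : (B₀.restrict S).IsAlt := fun w => h₀ w
  obtain ⟨⟨y, hyS⟩, hy, hy0⟩ := h₀S.exists_ne_zero_of_odd_finrank 1 hS
  replace hy : y ≠ 0 := fun h => hy (Subtype.ext h)
  obtain ⟨g, hg⟩ := hdual hy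
  obtain ⟨⟨z, hzS⟩, hzG, hz⟩ : ∃ z : S, z ∈ LinearMap.ker (((B₁ y).prod g).domRestrict S) ∧ z ≠ 0 :=
    Submodule.exists_mem_ne_zero_of_ne_bot
      (LinearMap.ker_ne_bot_of_finrank_lt (by simp [hS]))
  replace hz : z ≠ 0 := fun h => hz (Subtype.ext h)
  have hxy : B₁ x y = 0 := congrArg Prod.fst (hSF hyS)
  have hfy : f y = 0 := congrArg Prod.snd (hSF hyS)
  have hxz : B₁ x z = 0 := congrArg Prod.fst (hSF hzS)
  have hfz : f z = 0 := congrArg Prod.snd (hSF hzS)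
  have hyz : B₁ y z = 0 := congrArg Prod.fst hzG
  have hgz : g z = 0 := congrArg Prod.snd hzG
  have hyz0 : B₀ y z = 0 := hy0 ⟨z, hzS⟩
  refine ⟨![x, y, z], ?_, ?_⟩
  · rw [Fintype.linearIndependent_iff]
    intro c hc
    simp only [Fin.sum_univ_three, Matrix.cons_val_zero, Matrix.cons_val_one, Matrix.cons_val] at hc
    have hc0 : c 0 = 0 := by simpa [hfy, hfz, hf] using congrArg f hc
    have hc1 : c 1 = 0 := by simpa [hc0, hgz, hg] using congrArg g hc
    have hc2 : c 2 = 0 := by simpa [hc0, hc1, hz] using hc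
    intro i
    fin_cases i <;> assumption
  · intro i j hij
    fin_cases i <;> fin_cases j <;> simp at hij <;> simp [hx0, hxy, hxz, hyz, hyz0]

/-! ### The point over the field of square roots -/

namespace QuadricPair

variable {k : Type u} [Field k] [CharP k 2] (X : QuadricPair k)

/-- In characteristic two, an intersection of two quadrics in `ℙ⁴_k` has a point over
`k^{1/2}`. -/
theorem nonempty_point_adjoinPthRoots : Nonempty (X.Point (AdjoinPthRoots k)) := by
  have : ExpChar k 2 := ExpChar.prime Nat.prime_two
  let L := AdjoinPthRoots k
  choose Q hQ using fun i => (X.isHomogeneous i).exists_quadraticForm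
  choose Q' hQ' using fun i => ((X.isHomogeneous i).map (algebraMap k L)).exists_quadraticForm
  have halt : (Q 0).polarBilin.IsAlt := fun v => by
    have h2 : (2 : k) = 0 := CharTwo.two_eq_zero
    simp [QuadraticMap.polar_self, h2]
  obtain ⟨v, hv, hiso⟩ := exists_linearIndependent_isotropic (by simp) (B₁ := (Q 1).polarBilin) halt
  replace hiso : ∀ l i j, i < j → QuadraticMap.polar (Q l) (v i) (v j) = 0 := by
    intro l i j hij
    fin_cases l
    exacts [(hiso i j hij).1, (hiso i j hij).2]
  let w : Fin 3 → Fin 5 → L := fun i => algebraMap k L ∘ v i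
  have hw : LinearIndependent L w := linearIndependent_algebraMap_comp_iff.mpr hv
  have hQw : ∀ l u, Q' l (algebraMap k L ∘ u) = algebraMap k L (Q l u) := by
    intro l u
    rw [hQ', hQ, MvPolynomial.eval_map, MvPolynomial.eval₂_comp]
  have hpol : ∀ l i j, i < j → QuadraticMap.polar (Q' l) (w i) (w j) = 0 := by
    intro l i j hij
    have hadd : w i + w j = algebraMap k L ∘ (v i + v j) := by
      ext m
      simp [w]
    rw [QuadraticMap.polar, hadd, hQw, hQw, hQw, ← map_sub, ← map_sub]
    exact (congrArg _ (hiso l i j hij)).trans (map_zero _)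
  let M : Matrix (Fin 2) (Fin 3) L := fun l j => AdjoinPthRoots.root k (Q l (v j))
  obtain ⟨y, hyM, hy⟩ : ∃ y, y ∈ LinearMap.ker M.mulVecLin ∧ y ≠ 0 :=
    Submodule.exists_mem_ne_zero_of_ne_bot (LinearMap.ker_ne_bot_of_finrank_lt (by simp))
  refine X.nonempty_point_of_aeval_eq_zero (∑ j, y j • w j) ?_ ?_
  · intro h
    exact hy (funext (Fintype.linearIndependent_iff.mp hw y h))
  · intro l
    have hl : ∑ j, M l j * y j = 0 := congrFun hyM l
    have hMsq : ∀ j, Q' l (w j) = M l j ^ 2 := fun j => by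
      rw [hQw, ← AdjoinPthRoots.root_pow 2]
    -- Squaring is additive here, so the squared linear equation is the diagonal quadratic equation.
    have hsq := congrArg (· ^ 2) hl
    rw [MvPolynomial.aeval_def, ← MvPolynomial.eval_map, ← hQ']
    have : CharP L 2 := charP_of_injective_algebraMap (algebraMap k L).injective 2
    simp only [Fin.sum_univ_three, CharTwo.add_sq] at hsq ⊢
    rw [QuadraticMap.map_add (Q' l), QuadraticMap.map_add (Q' l), QuadraticMap.polar_add_left]
    simp only [QuadraticMap.map_smul, QuadraticMap.polar_smul_left, QuadraticMap.polar_smul_right]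
    rw [hpol l 0 1 (by decide), hpol l 0 2 (by decide), hpol l 1 2 (by decide),
      hMsq, hMsq, hMsq]
    simp only [smul_eq_mul]
    linear_combination hsq

end QuadricPair

/-! ### The degree of the field of square roots -/

/-- If `1, t` is a basis of `k` over the field of its squares, then `[k^{1/2} : k] = 2`. -/
theorem finrank_adjoinPthRoots_eq_two {k : Type*} [Field k] [CharP k 2] (t : k)
    (ht : ∀ a : k, a ^ 2 ≠ t) (h : ∀ x : k, ∃ a b : k, x = a ^ 2 + t * b ^ 2) :
    Module.finrank k (AdjoinPthRoots k) = 2 := by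
  have : ExpChar k 2 := ExpChar.prime Nat.prime_two
  -- The ring isomorphism `r` carries the subfield of squares of `k` onto the copy of `k` in
  -- `k^{1/2}`.
  let r := AdjoinPthRoots.root k
  have hr : ∀ a : k, r (a ^ 2) = algebraMap k (AdjoinPthRoots k) a := fun a => by
    rw [map_pow, AdjoinPthRoots.root_pow 2]
  have hli : LinearIndependent k ![r 1, r t] := by
    rw [LinearIndependent.pair_iff]
    intro a b hab
    rw [Algebra.smul_def, Algebra.smul_def, ← hr, ← hr, ← map_mul, ← map_mul, ← map_add,
      map_eq_zero_iff r r.injective, mul_one] at hab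
    have hb : b = 0 := by
      by_contra hb
      refine ht (a / b) ?_
      rw [div_pow, div_eq_iff (pow_ne_zero 2 hb), mul_comm]
      exact CharTwo.add_eq_zero.mp hab
    subst hb
    simpa using hab
  have hsp : ⊤ ≤ Submodule.span k (Set.range ![r 1, r t]) := by
    rintro x -
    obtain ⟨x, rfl⟩ := r.surjective x
    obtain ⟨a, b, rfl⟩ := h x
    rw [Matrix.range_cons, Matrix.range_cons, Matrix.range_empty, Set.union_empty,
      Set.singleton_union, Submodule.mem_span_pair]
    refine ⟨a, b, ?_⟩
    rw [Algebra.smul_def, Algebra.smul_def, ← hr, ← hr, ← map_mul, ← map_mul, ← map_add, mul_one,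
      mul_comm]
  simpa using Module.finrank_eq_card_basis (Module.Basis.mk hli hsp)

/-- `[k^{1/2} : k]` does not change under finite extensions. -/
theorem finrank_adjoinPthRoots_of_finiteDimensional {E k : Type*} [Field E] [Field k] [Algebra E k]
    [FiniteDimensional E k] (p : ℕ) [ExpChar E p] [ExpChar k p] :
    Module.finrank k (AdjoinPthRoots k) = Module.finrank E (AdjoinPthRoots E) := by
  let rE := AdjoinPthRoots.root E
  let rk := AdjoinPthRoots.root k
  -- The inclusion of `E` in `k`, transported along the root isomorphisms; hence the two extensions
  -- have equal degree, and the two towers from `E` to `k^{1/2}` can be compared.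
  let _ : Algebra (AdjoinPthRoots E) (AdjoinPthRoots k) :=
    ((rk.toRingHom.comp (algebraMap E k)).comp rE.symm.toRingHom).toAlgebra
  let _ : Algebra E (AdjoinPthRoots k) :=
    ((algebraMap k (AdjoinPthRoots k)).comp (algebraMap E k)).toAlgebra
  have : IsScalarTower E k (AdjoinPthRoots k) := IsScalarTower.of_algebraMap_eq fun _ => rfl
  have : IsScalarTower E (AdjoinPthRoots E) (AdjoinPthRoots k) :=
    IsScalarTower.of_algebraMap_eq fun x => by
      change algebraMap k (AdjoinPthRoots k) (algebraMap E k x) =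
        rk (algebraMap E k (rE.symm (algebraMap E (AdjoinPthRoots E) x)))
      rw [← AdjoinPthRoots.root_pow p, ← AdjoinPthRoots.root_pow p, ← map_pow rE,
        RingEquiv.symm_apply_apply, map_pow, map_pow]
  have hequiv : Module.finrank E k = Module.finrank (AdjoinPthRoots E) (AdjoinPthRoots k) := by
    refine Algebra.finrank_eq_of_equiv_equiv rE rk ?_
    ext x
    change rk (algebraMap E k (rE.symm (rE x))) = rk (algebraMap E k x)
    rw [RingEquiv.symm_apply_apply]
  have h₁ := Module.finrank_mul_finrank E k (AdjoinPthRoots k)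
  have h₂ := Module.finrank_mul_finrank E (AdjoinPthRoots E) (AdjoinPthRoots k)
  rw [← h₁, ← hequiv, mul_comm] at h₂
  exact (Nat.eq_of_mul_eq_mul_left Module.finrank_pos h₂.symm)

/-! ### Global fields -/

/-- Over a perfect field of characteristic two, every polynomial is `a² + X b²`. -/
theorem Polynomial.exists_eq_sq_add_X_mul_sq {F : Type*} [Field F] [CharP F 2] [PerfectRing F 2]
    (p : Polynomial F) : ∃ a b : Polynomial F, p = a ^ 2 + X * b ^ 2 := by
  induction p using Polynomial.induction_on' with
  | add p q hp hq =>
    obtain ⟨a, b, rfl⟩ := hp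
    obtain ⟨c, d, rfl⟩ := hq
    refine ⟨a + c, b + d, ?_⟩
    rw [CharTwo.add_sq, CharTwo.add_sq]
    ring
  | monomial n c =>
    obtain ⟨d, rfl⟩ := surjective_frobenius F 2 c
    rw [frobenius_def, ← C_mul_X_pow_eq_monomial]
    obtain ⟨m, rfl | rfl⟩ := Nat.even_or_odd' n
    · exact ⟨C d * X ^ m, 0, by rw [C_pow]; ring⟩
    · exact ⟨0, C d * X ^ m, by rw [C_pow]; ring⟩

/-- `[F(t)^{1/2} : F(t)] = 2` for a perfect field `F` of characteristic two. -/
theorem RatFunc.finrank_adjoinPthRoots {F : Type*} [Field F] [CharP F 2] [PerfectRing F 2]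
    [CharP (RatFunc F) 2] : Module.finrank (RatFunc F) (AdjoinPthRoots (RatFunc F)) = 2 := by
  refine finrank_adjoinPthRoots_eq_two RatFunc.X (fun a ha => ?_) (fun x => ?_)
  · have ha0 : a ≠ 0 := by
      rintro rfl
      exact RatFunc.X_ne_zero (by simpa using ha.symm)
    -- A square has even degree, while `X` has degree 1.
    have h := congrArg RatFunc.intDegree ha
    rw [pow_two, RatFunc.intDegree_mul ha0 ha0, RatFunc.intDegree_X] at h
    omega
  · induction x using RatFunc.induction_on with
    | _ p q hq =>
      -- Writing `p / q = p q / q²` makes the denominator a square.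
      obtain ⟨a, b, hab⟩ := (p * q).exists_eq_sq_add_X_mul_sq
      have hq' : algebraMap (Polynomial F) (RatFunc F) q ≠ 0 := RatFunc.algebraMap_ne_zero hq
      refine ⟨algebraMap _ _ a / algebraMap _ _ q, algebraMap _ _ b / algebraMap _ _ q, ?_⟩
      have := congrArg (algebraMap (Polynomial F) (RatFunc F)) hab
      simp only [map_mul, map_add, map_pow, RatFunc.algebraMap_X] at this
      field_simp
      exact this

/-- `[k^{1/2} : k] = 2` for a global field `k` of characteristic two. -/
theorem IsGlobalField.finrank_adjoinPthRoots {k : Type*} [Field k] [CharP k 2]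
    (hk : IsGlobalField k) : Module.finrank k (AdjoinPthRoots k) = 2 := by
  obtain hk | ⟨F, _, _, _, hk⟩ := hk
  · have := CharP.eq k (inferInstance : CharP k 2) (CharP.ofCharZero k)
    omega
  · have : CharP (RatFunc F) 2 :=
      (algebraMap (RatFunc F) k).charP (algebraMap (RatFunc F) k).injective 2
    have : CharP F 2 :=
      (algebraMap F (RatFunc F)).charP (algebraMap F (RatFunc F)).injective 2
    have : ExpChar (RatFunc F) 2 := ExpChar.prime Nat.prime_two
    have : ExpChar k 2 := ExpChar.prime Nat.prime_two
    have : ExpChar F 2 := ExpChar.prime Nat.prime_two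
    have : PerfectRing F 2 := inferInstance
    rw [finrank_adjoinPthRoots_of_finiteDimensional (E := RatFunc F) 2,
      RatFunc.finrank_adjoinPthRoots]

/-! ### Local fields -/

open ValuativeRel in
/-- `[k^{1/2} : k] = 2` for a nonarchimedean local field `k` of characteristic two: if `π` is a
uniformizer, then every element of `k` is `a² + π b²`. -/
theorem IsNonarchimedeanLocalField.finrank_adjoinPthRoots (k : Type*) [Field k] [CharP k 2]
    [ValuativeRel k] [TopologicalSpace k] [IsNonarchimedeanLocalField k] :
    Module.finrank k (AdjoinPthRoots k) = 2 := by
  let _ := IsTopologicalAddGroup.rightUniformSpace k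
  have := isUniformAddGroup_of_addCommGroup (G := k)
  let O := 𝒪[k]
  have hinj : Function.Injective (algebraMap O k) := IsFractionRing.injective O k
  have : CharP O 2 := (algebraMap O k).charP hinj 2
  obtain ⟨π, hπ⟩ := IsDiscreteValuationRing.exists_irreducible O
  have hmod : ∀ x : O, ∃ a y : O, x = a ^ 2 + π * y := by
    intro x
    have : CharP 𝓀[k] 2 := by
      refine CharTwo.of_one_ne_zero_of_two_eq_zero one_ne_zero ?_
      have h2 : (2 : O) = 0 := CharTwo.two_eq_zero
      rw [← map_ofNat (IsLocalRing.residue O), h2, map_zero]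
    have : ExpChar 𝓀[k] 2 := ExpChar.prime Nat.prime_two
    have : PerfectRing 𝓀[k] 2 := inferInstance
    obtain ⟨b, hb⟩ := surjective_frobenius 𝓀[k] 2 (IsLocalRing.residue O x)
    obtain ⟨a, rfl⟩ := IsLocalRing.residue_surjective b
    rw [frobenius_def, ← map_pow, eq_comm, ← sub_eq_zero, ← map_sub, IsLocalRing.residue_eq_zero_iff,
      hπ.maximalIdeal_eq, Ideal.mem_span_singleton] at hb
    obtain ⟨y, hy⟩ := hb
    exact ⟨a, y, by rw [← hy]; ring⟩
  have happrox : ∀ (n : ℕ) (x : O), ∃ a b y : O, x = a ^ 2 + π * b ^ 2 + π ^ n * y := by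
    intro n
    induction n with
    | zero => exact fun x => ⟨0, 0, x, by ring⟩
    | succ n ih =>
      intro x
      obtain ⟨a, x', rfl⟩ := hmod x
      obtain ⟨b, c, y, rfl⟩ := ih x'
      -- Multiplying by `π` swaps the two terms: `a² + π (b² + π c²) = (a + π c)² + π b²`.
      refine ⟨a + π * c, b, y, ?_⟩
      rw [CharTwo.add_sq]
      ring
  have hsurj : ∀ x : O, ∃ a b : O, x = a ^ 2 + π * b ^ 2 := by
    intro x
    -- The solutions modulo the `n`-th power of the maximal ideal form nested nonempty closed sets
    -- in the compact `O × O`. A common point is an exact solution by Krull's intersection theorem.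
    let C : ℕ → Set (O × O) := fun n =>
      (fun c => x - (c.1 ^ 2 + π * c.2 ^ 2)) ⁻¹' ((𝓂[k] ^ n : Ideal O) : Set O)
    have hC : ∀ n, IsClosed (C n) := fun n =>
      (IsNoetherianRing.isClosed_ideal (𝓂[k] ^ n)).preimage (by fun_prop)
    obtain ⟨c, hc⟩ := (hC 0).isCompact.nonempty_iInter_of_sequence_nonempty_isCompact_isClosed C
      (fun n => Set.preimage_mono (Ideal.pow_le_pow_right n.le_succ)) (fun n => by
        obtain ⟨a, b, y, h⟩ := happrox n x
        refine ⟨(a, b), ?_⟩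
        change x - (a ^ 2 + π * b ^ 2) ∈ 𝓂[k] ^ n
        rw [hπ.maximalIdeal_eq, Ideal.span_singleton_pow, Ideal.mem_span_singleton]
        exact ⟨y, by rw [sub_eq_iff_eq_add', ← h]⟩) hC
    refine ⟨c.1, c.2, sub_eq_zero.mp ?_⟩
    rw [← Ideal.mem_bot, ← Ideal.iInf_pow_eq_bot_of_isLocalRing 𝓂[k] Ideal.IsPrime.ne_top',
      Ideal.mem_iInf]
    exact fun n => Set.mem_iInter.mp hc n
  refine finrank_adjoinPthRoots_eq_two (algebraMap O k π) (fun a ha => ?_) (fun x => ?_)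
  -- A square root of `π` in `k` would be integral, hence in `O`, but an irreducible element is not
  -- a square.
  · obtain ⟨b, rfl⟩ := IsIntegrallyClosed.exists_algebraMap_eq_of_isIntegral_pow (R := O) two_pos
      (ha ▸ isIntegral_algebraMap)
    rw [← map_pow] at ha
    exact hπ.not_isSquare ⟨b, by rw [← hinj ha, pow_two]⟩
  · obtain ⟨p, q, hq, rfl⟩ := IsFractionRing.div_surjective (A := O) x
    obtain ⟨a, b, hab⟩ := hsurj (p * q)
    have hq' : algebraMap O k q ≠ 0 :=
      (map_ne_zero_iff _ hinj).mpr (nonZeroDivisors.ne_zero hq)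
    refine ⟨algebraMap _ _ a / algebraMap _ _ q, algebraMap _ _ b / algebraMap _ _ q, ?_⟩
    have := congrArg (algebraMap O k) hab
    simp only [map_mul, map_add, map_pow] at this
    field_simp
    exact this

/-- `[k^{1/2} : k] = 2` for a local field `k` of characteristic two. -/
theorem IsLocalField.finrank_adjoinPthRoots {k : Type*} [Field k] [CharP k 2]
    (hk : IsLocalField k) : Module.finrank k (AdjoinPthRoots k) = 2 := by
  obtain ⟨_, _, _⟩ | ⟨⟨e⟩⟩ | ⟨⟨e⟩⟩ := hk
  · exact IsNonarchimedeanLocalField.finrank_adjoinPthRoots k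
  · have : CharP ℝ 2 := (e : k →+* ℝ).charP_iff_charP 2 |>.mp inferInstance
    have := CharP.eq ℝ this (CharP.ofCharZero ℝ)
    omega
  · have : CharP ℂ 2 := (e : k →+* ℂ).charP_iff_charP 2 |>.mp inferInstance
    have := CharP.eq ℂ this (CharP.ofCharZero ℂ)
    omega

/-- Here `AdjoinPthRoots k`, for `k` of characteristic two, is the extension `k^{1/2}` of `k`
obtained by adjoining the square roots of all elements of `k`. -/
theorem mainTheorem9 (k : Type u) [Field k] [CharP k 2] :
    (∀ X : QuadricPair k, X.IsSmoothCompleteIntersection →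
      Nonempty (X.Point (AdjoinPthRoots k))) ∧
    (IsLocalField k ∨ IsGlobalField k →
      Module.finrank k (AdjoinPthRoots k) = 2 ∧
      ∀ X : QuadricPair k, X.IsSmoothCompleteIntersection →
        ∃ (K : Type u) (_ : Field K) (_ : Algebra k K),
          Module.finrank k K = 2 ∧ Nonempty (X.Point K)) := by
  refine ⟨fun X _ => X.nonempty_point_adjoinPthRoots, fun hk => ?_⟩
  have h : Module.finrank k (AdjoinPthRoots k) = 2 :=
    hk.elim IsLocalField.finrank_adjoinPthRoots IsGlobalField.finrank_adjoinPthRoots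
  exact ⟨h, fun X _ => ⟨AdjoinPthRoots k, inferInstance, inferInstance, h,
    X.nonempty_point_adjoinPthRoots⟩⟩
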